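/- Let $k$ be a field, let $C$ be a $k$-coalgebra, and let $C^*=\mathrm{Hom}_k(C,k)$ be its dual algebra, with the convolution product $(fg)(c)=\sum f(c_1)g(c_2)$. A left $C$-comodule $M$ with structure map $\rho(m)=\sum m_{-1}\otimes m_0$ is a right $C^*$-module by $m\cdot f=\sum f(m_{-1})m_0$; a right $C^*$-module is called rational if its module structure arises in this way from a left $C$-comodule structure. Symmetrically, a right $C$-comodule $N$ with structure map $\rho(n)=\sum n_0\otimes n_1$ is a left $C^*$-module by $f\cdot n=\sum f(n_1)n_0$, and its dual $N^*=\mathrm{Hom}_k(N,k)$ is a right $C^*$-module by $(g\cdot f)(n)=g(f\cdot n)$. A projective cover of a module $M$ is a surjective morphism $P\to M$ with $P$ projective and with superfluous kernel. Let $M$ be a simple right $C^*$-module. Then $M$ has a projective cover in the category of right $C^*$-modules if and only if $M$ is rational; and $M$ is rational if and only if its module structure comes from a simple left $C$-comodule structure on $M$. Moreover, suppose that $M$ is rational. Then the dual space $S=M^*$, with the left $C^*$-action $(f\cdot\varphi)(m)=\varphi(m\cdot f)$, has a unique right $C$-comodule structure inducing this action. With it $S$ is a simple right $C$-comodule, and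 evaluation $M\to S^*$ is an isomorphism of right $C^*$-modules. The comodule $S$ has an injective envelope in the category of right $C$-comodules, and for every such envelope $\iota:S\to E(S)$ the composite $E(S)^*\xrightarrow{\ \iota^*\ }S^*\cong M$ is a projective cover of the right $C^*$-module $M$. -/

import Mathlib

open scoped TensorProduct
open MulOpposite

universe u v w x

/-- The dual algebra `C^*` of a coalgebra `C`: linear forms on `C` with the convolution product
`(f * g)(c) = ∑ f(c₁) g(c₂)` and unit the counit. Right `C^*`-modules are modules over
`(DualAlgebra k C)ᵐᵒᵖ`, the action `m · f` being `op f • m`. -/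
abbrev DualAlgebra (k : Type u) (C : Type v) [Field k] [AddCommGroup C] [Module k C]
    [Coalgebra k C] : Type (max u v) :=
  WithConv (C →ₗ[k] k)

section ProjectiveCover

variable {R P M : Type*} [Ring R] [AddCommGroup P] [Module R P] [AddCommGroup M] [Module R M]

/-- `p : P → M` is a projective cover: `P` is projective, `p` is onto, and `ker p` is
superfluous in `P`. -/
structure IsProjectiveCover (p : P →ₗ[R] M) : Prop where
  projective : Module.Projective R P
  surjective : Function.Surjective p
  superfluous : ∀ N : Submodule R P, N ⊔ LinearMap.ker p = ⊤ → N = ⊤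

end ProjectiveCover

/-- `M` has a projective cover (with underlying type in the universe `x`). -/
def HasProjectiveCover (R : Type u) (M : Type v) [Ring R] [AddCommGroup M] [Module R M] : Prop :=
  ∃ (P : Type x) (_ : AddCommGroup P) (_ : Module R P) (p : P →ₗ[R] M), IsProjectiveCover p

/-- A left `C`-comodule structure `ρ : M → C ⊗ M` on the vector space `M`. -/
class LeftComodule (k : Type u) (C : Type v) (M : Type w) [Field k] [AddCommGroup C] [Module k C]
    [Coalgebra k C] [AddCommGroup M] [Module k M] where
  coact : M →ₗ[k] C ⊗[k] M
  coassoc : (TensorProduct.assoc k C C M).toLinearMap ∘ₗ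
      (Coalgebra.comul (R := k) (A := C)).rTensor M ∘ₗ coact = coact.lTensor C ∘ₗ coact
  counit_coact : (TensorProduct.lid k M).toLinearMap ∘ₗ
      (Coalgebra.counit (R := k) (A := C)).rTensor M ∘ₗ coact = LinearMap.id

/-- A right `C`-comodule structure `ρ : N → N ⊗ C` on the vector space `N`. -/
class RightComodule (k : Type u) (C : Type v) (N : Type w) [Field k] [AddCommGroup C] [Module k C]
    [Coalgebra k C] [AddCommGroup N] [Module k N] where
  coact : N →ₗ[k] N ⊗[k] C
  coassoc : (TensorProduct.assoc k N C C).toLinearMap ∘ₗ coact.rTensor C ∘ₗ coact =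
      (Coalgebra.comul (R := k) (A := C)).lTensor N ∘ₗ coact
  counit_coact : (TensorProduct.rid k N).toLinearMap ∘ₗ
      (Coalgebra.counit (R := k) (A := C)).lTensor N ∘ₗ coact = LinearMap.id

namespace LeftComodule

variable (k : Type u) (C : Type v) (M : Type w) [Field k] [AddCommGroup C] [Module k C]
  [Coalgebra k C] [AddCommGroup M] [Module k M]

variable {k C M} in
/-- The right action of `C^*` on a left comodule: `m · f = ∑ f(m₋₁) m₀`. -/
def act [LeftComodule k C M] (f : DualAlgebra k C) : M →ₗ[k] M :=
  (TensorProduct.lid k M).toLinearMap ∘ₗ f.ofConv.rTensor M ∘ₗ coact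

/-- `W` is a subcomodule: `ρ(W) ⊆ C ⊗ W`. -/
def IsSubcomodule [LeftComodule k C M] (W : Submodule k M) : Prop :=
  ∀ m ∈ W, coact (C := C) m ∈ LinearMap.range (W.subtype.lTensor C)

/-- A simple left comodule: nonzero, with no subcomodules but `0` and itself. -/
def IsSimple [LeftComodule k C M] : Prop :=
  Nontrivial M ∧ ∀ W : Submodule k M, IsSubcomodule k C M W → W = ⊥ ∨ W = ⊤

/-- The left comodule structure on `M` induces the given right `C^*`-module structure. -/
def Induces [Module (DualAlgebra k C)ᵐᵒᵖ M] [LeftComodule k C M] : Prop :=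
  ∀ (f : DualAlgebra k C) (m : M), op f • m = act f m

end LeftComodule

/-- A right `C^*`-module is rational if its structure comes from a left `C`-comodule structure. -/
def IsRational (k : Type u) (C : Type v) (M : Type w) [Field k] [AddCommGroup C] [Module k C]
    [Coalgebra k C] [AddCommGroup M] [Module k M] [Module (DualAlgebra k C)ᵐᵒᵖ M] : Prop :=
  ∃ _ : LeftComodule k C M, LeftComodule.Induces k C M

namespace RightComodule

section Basic

variable {k : Type u} {C : Type v} {N : Type w} [Field k] [AddCommGroup C] [Module k C]
  [Coalgebra k C] [AddCommGroup N] [Module k N]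

/-- The left action of `C^*` on a right comodule: `f · n = ∑ f(n₁) n₀`. -/
def act [RightComodule k C N] (f : DualAlgebra k C) : N →ₗ[k] N :=
  (TensorProduct.rid k N).toLinearMap ∘ₗ f.ofConv.lTensor N ∘ₗ coact

theorem act_one [RightComodule k C N] : act (N := N) (1 : DualAlgebra k C) = LinearMap.id :=
  counit_coact

theorem act_zero [RightComodule k C N] : act (N := N) (0 : DualAlgebra k C) = 0 := by
  ext n
  simp [act]

theorem act_add [RightComodule k C N] (f g : DualAlgebra k C) :
    act (N := N) (f + g) = act f + act g := by
  ext n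
  simp [act, LinearMap.lTensor_add]

theorem act_mul [RightComodule k C N] (f g : DualAlgebra k C) :
    act (N := N) (f * g) = act f ∘ₗ act g := by
  have key : (TensorProduct.rid k N).toLinearMap ∘ₗ (f * g).ofConv.lTensor N =
      (TensorProduct.rid k N).toLinearMap ∘ₗ f.ofConv.lTensor N ∘ₗ
        (TensorProduct.rid k (N ⊗[k] C)).toLinearMap ∘ₗ g.ofConv.lTensor (N ⊗[k] C) ∘ₗ
        (TensorProduct.assoc k N C C).symm.toLinearMap ∘ₗ
        (Coalgebra.comul (R := k) (A := C)).lTensor N := by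
    ext n c
    simp only [TensorProduct.AlgebraTensorModule.curry_apply, TensorProduct.curry_apply,
      LinearMap.restrictScalars_self, LinearMap.comp_apply, LinearMap.lTensor_tmul,
      LinearEquiv.coe_coe, TensorProduct.rid_tmul]
    rw [show (f * g).ofConv c = _ from LinearMap.convMul_apply f g c]
    induction Coalgebra.comul (R := k) c using TensorProduct.induction_on with
    | zero => simp
    | tmul a b =>
      simp only [TensorProduct.map_tmul, LinearMap.mul'_apply, TensorProduct.assoc_symm_tmul,
        LinearMap.lTensor_tmul, TensorProduct.rid_tmul, map_smul, smul_smul, mul_comm]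
    | add a b ha hb => simp only [map_add, add_smul, TensorProduct.tmul_add, ha, hb]
  have nat : ∀ t : N ⊗[k] C, coact (C := C) (TensorProduct.rid k N (g.ofConv.lTensor N t)) =
      TensorProduct.rid k (N ⊗[k] C) (g.ofConv.lTensor (N ⊗[k] C) (coact.rTensor C t)) := by
    intro t
    induction t using TensorProduct.induction_on with
    | zero => simp
    | tmul a b => simp
    | add a b ha hb => simp only [map_add, ha, hb]
  ext n
  have h1 := LinearMap.congr_fun key (coact n)
  have h2 := LinearMap.congr_fun (coassoc (k := k) (C := C) (N := N)) n
  simp only [LinearMap.comp_apply, LinearEquiv.coe_coe] at h1 h2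
  simp only [act, LinearMap.comp_apply, LinearEquiv.coe_coe]
  rw [h1, nat, ← h2, LinearEquiv.symm_apply_apply]

/-- The dual `N^*` of a right comodule is a right `C^*`-module: `(g · f)(n) = g(f · n)`. -/
instance dualModule [RightComodule k C N] : Module (DualAlgebra k C)ᵐᵒᵖ (Module.Dual k N) where
  smul f g := g ∘ₗ act f.unop
  one_smul g := by
    change g ∘ₗ act (1 : DualAlgebra k C) = g
    rw [act_one, LinearMap.comp_id]
  mul_smul a b g := by
    change g ∘ₗ act (b.unop * a.unop) = (g ∘ₗ act b.unop) ∘ₗ act a.unop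
    rw [act_mul, LinearMap.comp_assoc]
  smul_zero a := LinearMap.zero_comp _
  smul_add a g h := LinearMap.add_comp _ _ _
  add_smul a b g := by
    change g ∘ₗ act (a.unop + b.unop) = g ∘ₗ act a.unop + g ∘ₗ act b.unop
    rw [act_add, LinearMap.comp_add]
  zero_smul g := by
    change g ∘ₗ act (0 : DualAlgebra k C) = 0
    rw [act_zero, LinearMap.comp_zero]

end Basic

section Notions

variable (k : Type u) (C : Type v) (N : Type w) [Field k] [AddCommGroup C] [Module k C]
  [Coalgebra k C] [AddCommGroup N] [Module k N]

/-- `W` is a subcomodule: `ρ(W) ⊆ W ⊗ C`. -/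
def IsSubcomodule [RightComodule k C N] (W : Submodule k N) : Prop :=
  ∀ n ∈ W, coact (C := C) n ∈ LinearMap.range (W.subtype.rTensor C)

/-- A simple right comodule: nonzero, with no subcomodules but `0` and itself. -/
def IsSimple [RightComodule k C N] : Prop :=
  Nontrivial N ∧ ∀ W : Submodule k N, IsSubcomodule k C N W → W = ⊥ ∨ W = ⊤

/-- For a right `C^*`-module `M`, the dual `M^*` is a left `C^*`-module by
`(f · φ)(m) = φ(m · f)`. The right comodule structure on `M^*` induces this module structure. -/
def InducesDual (M : Type w) [AddCommGroup M] [Module k M] [Module (DualAlgebra k C)ᵐᵒᵖ M]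
    [RightComodule k C (Module.Dual k M)] : Prop :=
  ∀ (f : DualAlgebra k C) (φ : Module.Dual k M) (m : M), act f φ m = φ (op f • m)

end Notions

section Hom

variable (k : Type u) (C : Type v) [Field k] [AddCommGroup C] [Module k C] [Coalgebra k C]

/-- A linear map is a morphism of right comodules: `ρ ∘ h = (h ⊗ id) ∘ ρ`. -/
def IsHom {X Y : Type*} [AddCommGroup X] [Module k X] [RightComodule k C X]
    [AddCommGroup Y] [Module k Y] [RightComodule k C Y] (h : X →ₗ[k] Y) : Prop :=
  coact (C := C) ∘ₗ h = h.rTensor C ∘ₗ coact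

/-- `E` is an injective object of the category of right `C`-comodules. -/
def IsInjective (E : Type w) [AddCommGroup E] [Module k E] [RightComodule k C E] : Prop :=
  ∀ (X Y : Type w) [AddCommGroup X] [Module k X] [RightComodule k C X]
    [AddCommGroup Y] [Module k Y] [RightComodule k C Y] (i : X →ₗ[k] Y) (h : X →ₗ[k] E),
    IsHom k C i → Function.Injective i → IsHom k C h →
      ∃ g : Y →ₗ[k] E, IsHom k C g ∧ g ∘ₗ i = h

/-- `ι : S → E` is an injective envelope in the category of right `C`-comodules: a monomorphism
into an injective comodule whose image meets every nonzero subcomodule of `E`. -/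
structure IsInjectiveEnvelope {S : Type x} {E : Type w} [AddCommGroup S] [Module k S]
    [RightComodule k C S] [AddCommGroup E] [Module k E] [RightComodule k C E]
    (ι : S →ₗ[k] E) : Prop where
  isHom : IsHom k C ι
  injective : Function.Injective ι
  isInjective : IsInjective k C E
  essential : ∀ W : Submodule k E, IsSubcomodule k C E W → W ⊓ LinearMap.range ι = ⊥ → W = ⊥

variable {k C}

theorem IsHom.act_comm {X Y : Type*} [AddCommGroup X] [Module k X] [RightComodule k C X]
    [AddCommGroup Y] [Module k Y] [RightComodule k C Y] {h : X →ₗ[k] Y} (hh : IsHom k C h)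
    (f : DualAlgebra k C) : act f ∘ₗ h = h ∘ₗ act f := by
  have nat : ∀ t : X ⊗[k] C, TensorProduct.rid k Y (f.ofConv.lTensor Y (h.rTensor C t)) =
      h (TensorProduct.rid k X (f.ofConv.lTensor X t)) := by
    intro t
    induction t using TensorProduct.induction_on with
    | zero => simp
    | tmul a b => simp
    | add a b ha hb => simp only [map_add, ha, hb]
  ext n
  have h1 := LinearMap.congr_fun hh n
  simp only [LinearMap.comp_apply] at h1
  simp only [act, LinearMap.comp_apply, LinearEquiv.coe_coe]
  rw [h1, nat]

/-- The dual `h^* : Y^* → X^*`, `g ↦ g ∘ h`, of a comodule morphism `h : X → Y`, as a morphism of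
right `C^*`-modules. -/
def dualMap {X Y : Type*} [AddCommGroup X] [Module k X] [RightComodule k C X]
    [AddCommGroup Y] [Module k Y] [RightComodule k C Y] (h : X →ₗ[k] Y) (hh : IsHom k C h) :
    Module.Dual k Y →ₗ[(DualAlgebra k C)ᵐᵒᵖ] Module.Dual k X where
  toFun g := g ∘ₗ h
  map_add' g g' := LinearMap.add_comp _ _ _
  map_smul' f g := by
    change (g ∘ₗ act f.unop) ∘ₗ h = (g ∘ₗ h) ∘ₗ act f.unop
    rw [LinearMap.comp_assoc, hh.act_comm, LinearMap.comp_assoc]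

end Hom

end RightComodule

/-! Comodule questions become questions about `C^*`: contractions with linear forms separate the
elements of `N ⊗ C`, so coactions, morphisms and subcomodules can be read off from the action of
`C^*`. Suppose `p : P → M` is a projective cover. As `M` is simple and the kernel superfluous, every
proper submodule of `P` lies in `ker p`, so `P = x C^*`, which splits off `C^*` as `e C^*` with `e`
idempotent. A nonzero `c` fixed by `c ↦ ∑ e(c₁) c₂` generates a finite-dimensional subcomodule `F`
of `C`. With `I` its annihilator, `x I` is proper, hence killed by `p`. So `f ↦ p(x) · f` depends
only on `f` restricted to `F`, and `M` is rational (`IsProjectiveCover.isRational`). Suppose `M` is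
rational. Then it is finite-dimensional and `S = M^*` is a simple comodule. Linear forms on a
comodule correspond to morphisms into `C` (`coeffMap`); hence `C` is injective, `S` embeds in `C`,
and a maximal essential extension of `S` inside `C` is a direct summand, an envelope
(`exists_isInjectiveEnvelope`). For any envelope `E`, a form not vanishing on `S` embeds `E` in `C`
by essentiality; this makes `E^*` a summand of `C^*`, and each such form generates `E^*`, so the
kernel of `E^* → S^*` is superfluous (`IsInjectiveEnvelope.isProjectiveCover`). -/

/-! ### Contraction of tensors with linear forms. -/

section Contraction

variable {k C : Type*} [Field k] [AddCommGroup C] [Module k C]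

/-- Contraction of the right tensor factor with a linear form, `n ⊗ c ↦ f(c) n`. -/
def contractRightFactor (N : Type*) [AddCommGroup N] [Module k N] (f : C →ₗ[k] k) :
    N ⊗[k] C →ₗ[k] N :=
  (TensorProduct.rid k N).toLinearMap ∘ₗ f.lTensor N

/-- Contraction of the left tensor factor with a linear form, `c ⊗ m ↦ f(c) m`. -/
def contractLeftFactor (M : Type*) [AddCommGroup M] [Module k M] (f : C →ₗ[k] k) :
    C ⊗[k] M →ₗ[k] M :=
  (TensorProduct.lid k M).toLinearMap ∘ₗ f.rTensor M

variable {M N : Type*} [AddCommGroup N] [Module k N] [AddCommGroup M] [Module k M]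

@[simp]
theorem contractRightFactor_tmul (f : C →ₗ[k] k) (n : N) (c : C) :
    contractRightFactor N f (n ⊗ₜ c) = f c • n := by
  simp [contractRightFactor]

@[simp]
theorem contractLeftFactor_tmul (f : C →ₗ[k] k) (m : M) (c : C) :
    contractLeftFactor M f (c ⊗ₜ m) = f c • m := by
  simp [contractLeftFactor]

/-- Contracting with the coordinate forms of a basis of `C` recovers the coefficients of a tensor.
-/
theorem contractRightFactor_ext {s t : N ⊗[k] C}
    (h : ∀ f : C →ₗ[k] k, contractRightFactor N f s = contractRightFactor N f t) : s = t := by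
  classical
  let b := Module.Basis.ofVectorSpace k C
  apply (TensorProduct.equivFinsuppOfBasisRight (M := N) b).injective
  ext i
  rw [TensorProduct.equivFinsuppOfBasisRight_apply, TensorProduct.equivFinsuppOfBasisRight_apply]
  exact h _

theorem contractLeftFactor_ext {s t : C ⊗[k] M}
    (h : ∀ f : C →ₗ[k] k, contractLeftFactor M f s = contractLeftFactor M f t) : s = t := by
  classical
  let b := Module.Basis.ofVectorSpace k C
  apply (TensorProduct.equivFinsuppOfBasisLeft (N := M) b).injective
  ext i
  rw [TensorProduct.equivFinsuppOfBasisLeft_apply, TensorProduct.equivFinsuppOfBasisLeft_apply]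
  exact h _

theorem contractRightFactor_rTensor {X Y : Type*} [AddCommGroup X] [Module k X] [AddCommGroup Y]
    [Module k Y] (h : X →ₗ[k] Y) (f : C →ₗ[k] k) (t : X ⊗[k] C) :
    contractRightFactor Y f (h.rTensor C t) = h (contractRightFactor X f t) := by
  induction t using TensorProduct.induction_on with
  | zero => simp
  | tmul a b => simp
  | add a b ha hb => simp only [map_add, ha, hb]

theorem contractLeftFactor_lTensor {X Y : Type*} [AddCommGroup X] [Module k X] [AddCommGroup Y]
    [Module k Y] (h : X →ₗ[k] Y) (f : C →ₗ[k] k) (t : C ⊗[k] X) :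
    contractLeftFactor Y f (h.lTensor C t) = h (contractLeftFactor X f t) := by
  induction t using TensorProduct.induction_on with
  | zero => simp
  | tmul a b => simp
  | add a b ha hb => simp only [map_add, ha, hb]

theorem exists_finite_contractRightFactor_mem (t : N ⊗[k] C) :
    ∃ W : Submodule k N, FiniteDimensional k W ∧ ∀ f, contractRightFactor N f t ∈ W := by
  induction t using TensorProduct.induction_on with
  | zero => exact ⟨⊥, inferInstance, by simp⟩
  | tmul a b =>
    refine ⟨k ∙ a, inferInstance, fun f => ?_⟩
    rw [contractRightFactor_tmul]
    exact Submodule.smul_mem _ _ (Submodule.mem_span_singleton_self a)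
  | add a b ha hb =>
    obtain ⟨V, _, hV⟩ := ha
    obtain ⟨W, _, hW⟩ := hb
    refine ⟨V ⊔ W, inferInstance, fun f => ?_⟩
    rw [map_add]
    exact Submodule.add_mem_sup (hV f) (hW f)

theorem exists_finite_contractLeftFactor_mem (t : C ⊗[k] M) :
    ∃ W : Submodule k M, FiniteDimensional k W ∧ ∀ f, contractLeftFactor M f t ∈ W := by
  induction t using TensorProduct.induction_on with
  | zero => exact ⟨⊥, inferInstance, by simp⟩
  | tmul a b =>
    refine ⟨k ∙ b, inferInstance, fun f => ?_⟩
    rw [contractLeftFactor_tmul]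
    exact Submodule.smul_mem _ _ (Submodule.mem_span_singleton_self b)
  | add a b ha hb =>
    obtain ⟨V, _, hV⟩ := ha
    obtain ⟨W, _, hW⟩ := hb
    refine ⟨V ⊔ W, inferInstance, fun f => ?_⟩
    rw [map_add]
    exact Submodule.add_mem_sup (hV f) (hW f)

/-- Pure contractions with two linear forms separate the points of `N ⊗ (C ⊗ C)`. -/
theorem contractRightFactor_mul_ext {s t : N ⊗[k] (C ⊗[k] C)}
    (h : ∀ f g : C →ₗ[k] k,
      contractRightFactor N (LinearMap.mul' k k ∘ₗ TensorProduct.map f g) s =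
        contractRightFactor N (LinearMap.mul' k k ∘ₗ TensorProduct.map f g) t) : s = t := by
  have key : ∀ (f g : C →ₗ[k] k) (t : N ⊗[k] (C ⊗[k] C)),
      contractRightFactor N f (contractRightFactor (N ⊗[k] C) g
        ((TensorProduct.assoc k N C C).symm t)) =
      contractRightFactor N (LinearMap.mul' k k ∘ₗ TensorProduct.map f g) t := by
    intro f g t
    have : contractRightFactor N f ∘ₗ contractRightFactor (N ⊗[k] C) g ∘ₗ
        (TensorProduct.assoc k N C C).symm.toLinearMap =
        contractRightFactor N (LinearMap.mul' k k ∘ₗ TensorProduct.map f g) := by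
      ext n c d
      simp [smul_smul, mul_comm]
    exact LinearMap.congr_fun this t
  apply (TensorProduct.assoc k N C C).symm.injective
  refine contractRightFactor_ext fun g => contractRightFactor_ext fun f => ?_
  rw [key, key, h]

/-- Pure contractions with two linear forms separate the points of `C ⊗ (C ⊗ M)`. -/
theorem contractLeftFactor_contractLeftFactor_ext {s t : C ⊗[k] (C ⊗[k] M)}
    (h : ∀ f g : C →ₗ[k] k,
      contractLeftFactor M g (contractLeftFactor (C ⊗[k] M) f s) =
        contractLeftFactor M g (contractLeftFactor (C ⊗[k] M) f t)) : s = t :=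
  contractLeftFactor_ext fun f => contractLeftFactor_ext fun g => h f g

/-- A linear map on `C^*` that vanishes on the annihilator of a finite-dimensional subspace of `C`
is the contraction with an element of `C ⊗ M`. -/
theorem exists_eq_contractLeftFactor (F : Submodule k C) [FiniteDimensional k F]
    (θ : Module.Dual k C →ₗ[k] M) (h : ∀ f : Module.Dual k C, (∀ c ∈ F, f c = 0) → θ f = 0) :
    ∃ t : C ⊗[k] M, ∀ f : Module.Dual k C, θ f = contractLeftFactor M f t := by
  obtain ⟨π, hπ⟩ := F.subtype.exists_leftInverse_of_injective F.ker_subtype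
  have hπ' : ∀ c : F, π c = c := LinearMap.congr_fun hπ
  let b := Module.finBasis k F
  -- On `F` the form `f` agrees with `∑ f(bᵢ) (bᵢ^* ∘ π)`, where `π` projects `C` onto `F`, so `θ`
  -- takes the same value on both.
  refine ⟨∑ i, (b i : C) ⊗ₜ[k] θ (b.coord i ∘ₗ π), fun f => ?_⟩
  rw [map_sum]
  simp only [contractLeftFactor_tmul]
  rw [← sub_eq_zero, ← Finset.sum_congr rfl fun i _ => map_smul θ _ _, ← map_sum, ← map_sub]
  refine h _ fun c hc => ?_
  have h1 := congrArg (fun y : F => f (y : C)) (b.sum_repr ⟨c, hc⟩)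
  simp only [Submodule.coe_sum, Submodule.coe_smul, map_sum, map_smul, smul_eq_mul] at h1
  simp only [LinearMap.sub_apply, LinearMap.sum_apply, LinearMap.smul_apply, LinearMap.comp_apply,
    smul_eq_mul, hπ' ⟨c, hc⟩, Module.Basis.coord_apply]
  rw [sub_eq_zero, ← h1]
  exact Finset.sum_congr rfl fun i _ => mul_comm _ _

end Contraction

/-! ### Left comodules and rational modules. -/

namespace LeftComodule

variable {k C M : Type*} [Field k] [AddCommGroup C] [Module k C] [Coalgebra k C]
  [AddCommGroup M] [Module k M]

theorem act_apply [LeftComodule k C M] (f : DualAlgebra k C) (m : M) :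
    act f m = contractLeftFactor M f.ofConv (coact m) := rfl

theorem contractLeftFactor_comul (f g : DualAlgebra k C) (t : C ⊗[k] M) :
    contractLeftFactor M g.ofConv (contractLeftFactor (C ⊗[k] M) f.ofConv
      (TensorProduct.assoc k C C M ((Coalgebra.comul (R := k) (A := C)).rTensor M t))) =
    contractLeftFactor M (f * g).ofConv t := by
  have key : contractLeftFactor M g.ofConv ∘ₗ contractLeftFactor (C ⊗[k] M) f.ofConv ∘ₗ
      (TensorProduct.assoc k C C M).toLinearMap ∘ₗ
        (Coalgebra.comul (R := k) (A := C)).rTensor M = contractLeftFactor M (f * g).ofConv := by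
    ext c m
    simp only [TensorProduct.AlgebraTensorModule.curry_apply, TensorProduct.curry_apply,
      LinearMap.restrictScalars_self, LinearMap.comp_apply, LinearMap.rTensor_tmul,
      LinearEquiv.coe_coe, contractLeftFactor_tmul]
    rw [show (f * g).ofConv c = _ from LinearMap.convMul_apply f g c]
    induction Coalgebra.comul (R := k) c using TensorProduct.induction_on with
    | zero => simp
    | tmul a b => simp [smul_smul]
    | add a b ha hb => simp only [map_add, add_smul, TensorProduct.add_tmul, ha, hb]
  exact LinearMap.congr_fun key t

/-- A right `C^*`-module is rational as soon as every orbit map `f ↦ m · f` is given by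
contraction with an element of `C ⊗ M`. -/
theorem isRational_of_forall_exists [Module (DualAlgebra k C)ᵐᵒᵖ M]
    [IsScalarTower k (DualAlgebra k C)ᵐᵒᵖ M]
    (h : ∀ m : M, ∃ t : C ⊗[k] M, ∀ f : DualAlgebra k C,
      op f • m = contractLeftFactor M f.ofConv t) : IsRational k C M := by
  have : SMulCommClass k (DualAlgebra k C)ᵐᵒᵖ M := IsScalarTower.to_smulCommClass
  choose t ht using h
  let ρ : M →ₗ[k] C ⊗[k] M :=
    { toFun := t
      map_add' := fun a b => contractLeftFactor_ext fun f => by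
        rw [map_add, ← ht _ ⟨f⟩, ← ht _ ⟨f⟩, ← ht _ ⟨f⟩, smul_add]
      map_smul' := fun c a => contractLeftFactor_ext fun f => by
        rw [RingHom.id_apply, map_smul, ← ht _ ⟨f⟩, ← ht _ ⟨f⟩, smul_comm] }
  have hρ : ∀ (f : DualAlgebra k C) (m : M), contractLeftFactor M f.ofConv (ρ m) = op f • m :=
    fun f m => (ht m f).symm
  refine ⟨⟨ρ, ?_, ?_⟩, fun f m => ht m f⟩
  · ext m
    refine contractLeftFactor_contractLeftFactor_ext fun f g => ?_
    have h1 := contractLeftFactor_comul ⟨f⟩ ⟨g⟩ (ρ m)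
    have h2 := contractLeftFactor_lTensor ρ f (ρ m)
    simp only [LinearMap.comp_apply, LinearEquiv.coe_coe]
    rw [h1, h2, hρ, hρ ⟨f⟩, hρ ⟨g⟩, op_mul, mul_smul]
  · ext m
    exact (hρ 1 m).trans (one_smul _ m)

end LeftComodule

/-! ### Right comodules through the action of `C^*`; injectivity of `C`. -/

namespace RightComodule

section

variable {k C N : Type*} [Field k] [AddCommGroup C] [Module k C] [Coalgebra k C]
  [AddCommGroup N] [Module k N]

theorem act_apply [RightComodule k C N] (f : DualAlgebra k C) (n : N) :
    act f n = contractRightFactor N f.ofConv (coact n) := rfl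

/-- A representation of `C^*` all of whose orbit maps are contractions with an element of `N ⊗ C`
comes from a right comodule structure. -/
theorem exists_act_eq (a : DualAlgebra k C → N →ₗ[k] N) (one : a 1 = LinearMap.id)
    (mul : ∀ f g, a (f * g) = a f ∘ₗ a g)
    (h : ∀ n : N, ∃ t : N ⊗[k] C, ∀ f : DualAlgebra k C,
      a f n = contractRightFactor N f.ofConv t) :
    ∃ _ : RightComodule k C N, ∀ f : DualAlgebra k C, act f = a f := by
  choose t ht using h
  let ρ : N →ₗ[k] N ⊗[k] C :=
    { toFun := t
      map_add' := fun b c => contractRightFactor_ext fun f => by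
        rw [map_add, ← ht _ ⟨f⟩, ← ht _ ⟨f⟩, ← ht _ ⟨f⟩, map_add]
      map_smul' := fun c b => contractRightFactor_ext fun f => by
        rw [RingHom.id_apply, map_smul, ← ht _ ⟨f⟩, ← ht _ ⟨f⟩, map_smul] }
  have hρ : ∀ (f : DualAlgebra k C) (n : N), contractRightFactor N f.ofConv (ρ n) = a f n :=
    fun f n => (ht n f).symm
  refine ⟨⟨ρ, ?_, ?_⟩, fun f => LinearMap.ext fun n => (ht n f).symm⟩
  · ext n
    -- Contracted with `f ⊗ g`, coassociativity is the multiplicativity of `a`.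
    refine contractRightFactor_mul_ext fun f g => ?_
    have h1 : ∀ s : N ⊗[k] C, contractRightFactor N (LinearMap.mul' k k ∘ₗ TensorProduct.map f g)
        (TensorProduct.assoc k N C C (ρ.rTensor C s)) = a ⟨f⟩ (contractRightFactor N g s) := by
      intro s
      induction s using TensorProduct.induction_on with
      | zero => simp
      | tmul n c =>
        rw [LinearMap.rTensor_tmul, contractRightFactor_tmul, map_smul, ← hρ]
        induction ρ n using TensorProduct.induction_on with
        | zero => simp
        | tmul a b => simp [smul_smul, mul_comm]
        | add a b ha hb => simp only [TensorProduct.add_tmul, map_add, smul_add, ha, hb]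
      | add a b ha hb => simp only [map_add, ha, hb]
    have h2 : contractRightFactor N (LinearMap.mul' k k ∘ₗ TensorProduct.map f g)
        ((Coalgebra.comul (R := k) (A := C)).lTensor N (ρ n)) =
        contractRightFactor N ((⟨f⟩ * ⟨g⟩ : DualAlgebra k C)).ofConv (ρ n) := by
      generalize ρ n = s
      induction s using TensorProduct.induction_on with
      | zero => simp
      | tmul n c =>
        rw [LinearMap.lTensor_tmul, contractRightFactor_tmul, contractRightFactor_tmul]
        rfl
      | add a b ha hb => simp only [map_add, ha, hb]
    simp only [LinearMap.comp_apply, LinearEquiv.coe_coe]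
    rw [h1, h2, hρ ⟨g⟩, hρ, mul]
    rfl
  · ext n
    exact (hρ 1 n).trans (LinearMap.congr_fun one n)

theorem ext_of_act {σ τ : RightComodule k C N}
    (h : ∀ f : DualAlgebra k C, (letI := σ; act f : N →ₗ[k] N) = (letI := τ; act f)) : σ = τ := by
  have : σ.coact = τ.coact := LinearMap.ext fun n => contractRightFactor_ext fun f =>
    LinearMap.congr_fun (h ⟨f⟩) n
  cases σ
  cases τ
  congr

theorem isHom_iff {X Y : Type*} [AddCommGroup X] [Module k X] [RightComodule k C X]
    [AddCommGroup Y] [Module k Y] [RightComodule k C Y] {h : X →ₗ[k] Y} :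
    IsHom k C h ↔ ∀ f : DualAlgebra k C, act f ∘ₗ h = h ∘ₗ act f := by
  refine ⟨fun hh f => hh.act_comm f, fun hh => LinearMap.ext fun n =>
    contractRightFactor_ext fun f => ?_⟩
  simp only [LinearMap.comp_apply]
  rw [contractRightFactor_rTensor]
  exact LinearMap.congr_fun (hh ⟨f⟩) n

/-- By exactness of `W ⊗ C → N ⊗ C → (N/W) ⊗ C`, the coaction of `n` comes from `W ⊗ C` once its
image in `(N/W) ⊗ C` has zero contractions. -/
theorem isSubcomodule_iff [RightComodule k C N] {W : Submodule k N} :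
    IsSubcomodule k C N W ↔ ∀ f : DualAlgebra k C, ∀ n ∈ W, act f n ∈ W := by
  refine ⟨fun h f n hn => ?_, fun h n hn => ?_⟩
  · obtain ⟨t, ht⟩ := h n hn
    rw [act_apply, ← ht, contractRightFactor_rTensor]
    exact Subtype.property _
  · have hex : Function.Exact (W.subtype.rTensor C) (W.mkQ.rTensor C) :=
      rTensor_exact C (LinearMap.exact_subtype_mkQ W) W.mkQ_surjective
    refine (hex _).1 (contractRightFactor_ext fun f => ?_)
    rw [contractRightFactor_rTensor, map_zero]
    exact (Submodule.Quotient.mk_eq_zero W).2 (h ⟨f⟩ n hn)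

theorem isSubcomodule_ker {X Y : Type*} [AddCommGroup X] [Module k X] [RightComodule k C X]
    [AddCommGroup Y] [Module k Y] [RightComodule k C Y] {h : X →ₗ[k] Y} (hh : IsHom k C h) :
    IsSubcomodule k C X (LinearMap.ker h) := by
  refine isSubcomodule_iff.2 fun f n hn => ?_
  rw [LinearMap.mem_ker] at hn ⊢
  rw [← LinearMap.comp_apply, ← hh.act_comm, LinearMap.comp_apply, hn, map_zero]

theorem IsHom.comp {X Y Z : Type*} [AddCommGroup X] [Module k X] [RightComodule k C X]
    [AddCommGroup Y] [Module k Y] [RightComodule k C Y] [AddCommGroup Z] [Module k Z]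
    [RightComodule k C Z] {g : Y →ₗ[k] Z} {h : X →ₗ[k] Y} (hg : IsHom k C g) (hh : IsHom k C h) :
    IsHom k C (g ∘ₗ h) := by
  refine isHom_iff.2 fun f => ?_
  rw [← LinearMap.comp_assoc, hg.act_comm, LinearMap.comp_assoc, hh.act_comm,
    LinearMap.comp_assoc]

variable (k C) in
/-- The coalgebra as a right comodule over itself. -/
abbrev regular : RightComodule k C C where
  coact := Coalgebra.comul
  coassoc := Coalgebra.coassoc
  counit_coact := by
    ext c
    simp

/-- A comodule structure on a retract `V` of a comodule `N` whose projection is a morphism. -/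
theorem exists_of_retract [RightComodule k C N] {V : Type*} [AddCommGroup V] [Module k V]
    (j : V →ₗ[k] N) (r : N →ₗ[k] V) (hrj : r ∘ₗ j = LinearMap.id) (hjr : IsHom k C (j ∘ₗ r)) :
    ∃ _ : RightComodule k C V, IsHom k C j ∧ IsHom k C r := by
  have hr : ∀ v, r (j v) = v := LinearMap.congr_fun hrj
  have hc : ∀ (f : DualAlgebra k C) (n : N), act f (j (r n)) = j (r (act f n)) :=
    fun f n => LinearMap.congr_fun (hjr.act_comm f) n
  -- The compressed action is multiplicative because the idempotent `j ∘ r` commutes with `C^*`.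
  obtain ⟨σ, hσ⟩ := exists_act_eq (k := k) (C := C) (N := V) (fun f => r ∘ₗ act f ∘ₗ j)
    (by rw [act_one, LinearMap.id_comp, hrj])
    (fun f g => by
      ext v
      simp only [act_mul, LinearMap.comp_apply]
      rw [hc, hr])
    (fun v => ⟨r.rTensor C (coact (j v)), fun f => by rw [contractRightFactor_rTensor]; rfl⟩)
  refine ⟨σ, isHom_iff.2 fun f => ?_, isHom_iff.2 fun f => ?_⟩
  · ext v
    simp only [hσ, LinearMap.comp_apply]
    rw [← hc, hr]
  · ext n
    simp only [hσ, LinearMap.comp_apply]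
    rw [hc, hr]

/-- The morphism `n ↦ ∑ g(n₀) n₁` into the regular comodule attached to a linear form `g`. -/
def coeffMap [RightComodule k C N] (g : Module.Dual k N) : N →ₗ[k] C :=
  contractLeftFactor C g ∘ₗ coact

theorem apply_coeffMap [RightComodule k C N] (g : Module.Dual k N) (f : DualAlgebra k C) (n : N) :
    f.ofConv (coeffMap g n) = g (act f n) := by
  rw [coeffMap, act_apply, LinearMap.comp_apply]
  induction coact (k := k) (C := C) n using TensorProduct.induction_on with
  | zero => simp
  | tmul a b => simp [mul_comm]
  | add a b ha hb => simp only [map_add, ha, hb]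

theorem counit_coeffMap [RightComodule k C N] (g : Module.Dual k N) :
    Coalgebra.counit (R := k) (A := C) ∘ₗ coeffMap g = g := by
  ext n
  have := apply_coeffMap g (1 : DualAlgebra k C) n
  rw [act_one (k := k) (C := C)] at this
  exact this

theorem ext_forms {V : Type*} [AddCommGroup V] [Module k V] {a b : V}
    (h : ∀ f : Module.Dual k V, f a = f b) : a = b :=
  (Module.forall_dual_apply_eq_zero_iff k (a - b)).1 (fun f => by rw [map_sub, h, sub_self])
    |> sub_eq_zero.1

theorem mul_apply_eq (f g : DualAlgebra k C) (c : C) :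
    (f * g).ofConv c = f.ofConv ((letI := regular k C; act g : C →ₗ[k] C) c) := by
  let _ := regular k C
  rw [show (f * g).ofConv c = _ from LinearMap.convMul_apply f g c, act_apply]
  change _ = f.ofConv (contractRightFactor C g.ofConv (Coalgebra.comul c))
  induction Coalgebra.comul (R := k) c using TensorProduct.induction_on with
  | zero => simp
  | tmul a b => simp [mul_comm]
  | add a b ha hb => simp only [map_add, ha, hb]

theorem isHom_coeffMap [RightComodule k C N] (g : Module.Dual k N) :
    letI := regular k C
    IsHom k C (coeffMap (C := C) g) := by
  let _ := regular k C
  refine isHom_iff.2 fun f => ?_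
  ext n
  refine ext_forms (k := k) fun f' => ?_
  have h1 := mul_apply_eq ⟨f'⟩ f (coeffMap g n)
  rw [apply_coeffMap, act_mul] at h1
  exact h1.symm.trans (apply_coeffMap g ⟨f'⟩ (act f n)).symm

/-- Together with `counit_coeffMap` and `isHom_coeffMap`, this identifies morphisms `N → C` with
linear forms on `N`, so extending a morphism only requires extending a form. -/
theorem coeffMap_counit_comp [RightComodule k C N] {h : N →ₗ[k] C}
    (hh : letI := regular k C; IsHom k C h) :
    coeffMap (Coalgebra.counit (R := k) (A := C) ∘ₗ h) = h := by
  let _ := regular k C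
  ext n
  refine ext_forms (k := k) fun f => ?_
  have h1 := apply_coeffMap (Coalgebra.counit (R := k) (A := C) ∘ₗ h) ⟨f⟩ n
  have h2 := LinearMap.congr_fun (IsHom.act_comm hh ⟨f⟩) n
  have h3 := mul_apply_eq (1 : DualAlgebra k C) ⟨f⟩ (h n)
  rw [one_mul] at h3
  refine h1.trans ?_
  rw [LinearMap.comp_apply, ← LinearMap.comp_apply h, ← h2]
  exact h3.symm

/-- A comodule that is a retract of the regular comodule is injective. -/
theorem isInjective_of_retract {E : Type w} [AddCommGroup E] [Module k E] [RightComodule k C E]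
    (j : E →ₗ[k] C) (r : C →ₗ[k] E) (hrj : r ∘ₗ j = LinearMap.id)
    (hj : letI := regular k C; IsHom k C j) (hr : letI := regular k C; IsHom k C r) :
    IsInjective k C E := by
  intro X Y _ _ _ _ _ _ i h hi hinj hh
  let _ := regular k C
  obtain ⟨l, hl⟩ := i.exists_leftInverse_of_injective (LinearMap.ker_eq_bot.2 hinj)
  have hjh : IsHom k C (j ∘ₗ h) := IsHom.comp hj hh
  -- The form on `X` belonging to `j ∘ h`, extended to `Y` by the merely linear retraction `l`.
  let n : Module.Dual k Y := (Coalgebra.counit (R := k) (A := C) ∘ₗ j ∘ₗ h) ∘ₗ l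
  have hn : coeffMap n ∘ₗ i = j ∘ₗ h := by
    have h1 : IsHom k C (coeffMap (C := C) n ∘ₗ i) := IsHom.comp (isHom_coeffMap n) hi
    rw [← coeffMap_counit_comp h1, ← LinearMap.comp_assoc, counit_coeffMap,
      LinearMap.comp_assoc, hl, LinearMap.comp_id, coeffMap_counit_comp hjh]
  refine ⟨r ∘ₗ coeffMap n, IsHom.comp hr (isHom_coeffMap n), ?_⟩
  rw [LinearMap.comp_assoc, hn, ← LinearMap.comp_assoc, hrj, LinearMap.id_comp]

end

end RightComodule

/-! ### Injective envelopes of simple comodules and their duals. -/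

namespace RightComodule

section

variable {k : Type u} {C : Type v} {N : Type w} [Field k] [AddCommGroup C] [Module k C]
  [Coalgebra k C] [AddCommGroup N] [Module k N]

/-- Zorn's lemma; it supplies first a complement `K` of `S`, then a maximal `E ⊇ S` disjoint from
`K`. -/
theorem exists_maximal_disjoint [RightComodule k C N] {S K : Submodule k N}
    (hS : IsSubcomodule k C N S) (hSK : Disjoint S K) :
    ∃ E, S ≤ E ∧ Maximal (fun W => IsSubcomodule k C N W ∧ Disjoint W K) E := by
  refine zorn_le_nonempty₀ {W | IsSubcomodule k C N W ∧ Disjoint W K} (fun c hc hchain y hy => ?_)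
    S ⟨hS, hSK⟩
  refine ⟨sSup c, ⟨isSubcomodule_iff.2 fun f n hn => ?_, ?_⟩, fun z hz => le_sSup hz⟩
  · obtain ⟨W, hW, hn⟩ := (Submodule.mem_sSup_of_directed ⟨y, hy⟩ hchain.directedOn).1 hn
    exact le_sSup hW (isSubcomodule_iff.1 (hc hW).1 f n hn)
  · exact hchain.directedOn.disjoint_sSup_left.2 fun W hW => (hc hW).2

/-- Every subcomodule of the regular comodule is essential in the image of an idempotent
endomorphism. -/
theorem exists_idempotent_essential {S : Submodule k C}
    (hS : letI := regular k C; IsSubcomodule k C C S) :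
    letI := regular k C
    ∃ g : C →ₗ[k] C, IsHom k C g ∧ g ∘ₗ g = g ∧ S ≤ LinearMap.range g ∧
      ∀ W, IsSubcomodule k C C W → W ≤ LinearMap.range g → Disjoint W S → W = ⊥ := by
  let _ := regular k C
  obtain ⟨K, -, hK⟩ := exists_maximal_disjoint (k := k) (C := C) (N := C) (S := ⊥) (K := S)
    (isSubcomodule_iff.2 fun f n hn => by
      rw [Submodule.mem_bot] at hn ⊢
      rw [hn, map_zero]) disjoint_bot_left
  obtain ⟨E, hSE, hE⟩ := exists_maximal_disjoint hS hK.prop.2.symm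
  have hKs := isSubcomodule_iff.1 hK.prop.1
  have hEs := isSubcomodule_iff.1 hE.prop.1
  obtain ⟨E', hEE', hcompl⟩ := hE.prop.2.exists_isCompl
  -- As `E` and `K` are stable under `C^*`, a form equal to the counit on `E` and to zero on `K` has
  -- a coefficient map that is the identity on `E` and zero on `K`.
  let n : Module.Dual k C := LinearMap.ofIsCompl hcompl
    (Coalgebra.counit (R := k) (A := C) ∘ₗ E'.subtype) 0
  have hn1 : ∀ c ∈ E, n c = Coalgebra.counit (R := k) c := fun c hc =>
    LinearMap.ofIsCompl_apply_left hcompl (⟨c, hEE' hc⟩ : E')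
  have hn2 : ∀ c ∈ K, n c = 0 := fun c hc =>
    LinearMap.ofIsCompl_apply_right hcompl (⟨c, hc⟩ : K)
  let g : C →ₗ[k] C := coeffMap n
  have hg : IsHom k C g := isHom_coeffMap n
  have hgE : ∀ c ∈ E, g c = c := fun c hc => ext_forms (k := k) fun f => by
    have h1 := mul_apply_eq (1 : DualAlgebra k C) ⟨f⟩ c
    rw [one_mul] at h1
    exact (apply_coeffMap n ⟨f⟩ c).trans ((hn1 _ (hEs _ c hc)).trans h1.symm)
  have hgK : K ≤ LinearMap.ker g := fun c hc => ext_forms (k := k) fun f => by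
    rw [map_zero]
    exact (apply_coeffMap n ⟨f⟩ c).trans (hn2 _ (hKs _ c hc))
  have hess : ∀ W, IsSubcomodule k C C W → W ≤ LinearMap.range g → Disjoint W S → W = ⊥ := by
    intro W hW hWg hWS
    -- The preimage of `W` contains `K`, and it misses `S` because `g` fixes `S`; maximality of `K`
    -- applies.
    have hcomap : W.comap g ≤ K := by
      refine hK.le_of_ge ⟨isSubcomodule_iff.2 fun f c hc => ?_, ?_⟩ fun c hc => ?_
      · rw [Submodule.mem_comap, ← LinearMap.comp_apply, ← hg.act_comm, LinearMap.comp_apply]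
        exact isSubcomodule_iff.1 hW f _ hc
      · refine Submodule.disjoint_def.2 fun c hc hcS => ?_
        rw [Submodule.mem_comap, hgE c (hSE hcS)] at hc
        exact Submodule.disjoint_def.1 hWS c hc hcS
      · rw [Submodule.mem_comap, LinearMap.mem_ker.1 (hgK hc)]
        exact W.zero_mem
    refine (Submodule.eq_bot_iff _).2 fun c hc => ?_
    obtain ⟨d, rfl⟩ := hWg hc
    exact hgK (hcomap hc)
  have hrange : IsSubcomodule k C C (LinearMap.range g) := isSubcomodule_iff.2 fun f c hc => by
    obtain ⟨d, rfl⟩ := hc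
    exact ⟨act f d, LinearMap.congr_fun (hg.act_comm f).symm d⟩
  -- `range g ⊓ K` misses `S`, so it vanishes by `hess`; maximality of `E` then forces `range g =
  -- E`, which makes `g` idempotent.
  have hgr : LinearMap.range g ≤ E := by
    refine hE.le_of_ge ⟨hrange, disjoint_iff.2 (hess _ ?_ inf_le_left ?_)⟩
      fun c hc => ⟨c, hgE c hc⟩
    · exact isSubcomodule_iff.2 fun f c hc =>
        ⟨isSubcomodule_iff.1 hrange f c hc.1, hKs f c hc.2⟩
    · exact hK.prop.2.mono_left inf_le_right
  exact ⟨g, hg, LinearMap.ext fun c => hgE _ (hgr ⟨c, rfl⟩), fun c hc => ⟨c, hgE c (hSE hc)⟩, hess⟩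

theorem injective_of_isSimple {S Y : Type*} [AddCommGroup S] [Module k S] [RightComodule k C S]
    [AddCommGroup Y] [Module k Y] [RightComodule k C Y] (hS : IsSimple k C S) {h : S →ₗ[k] Y}
    (hh : IsHom k C h) (h0 : h ≠ 0) : Function.Injective h :=
  LinearMap.ker_eq_bot.1 ((hS.2 _ (isSubcomodule_ker hh)).resolve_right fun htop =>
    h0 (LinearMap.ker_eq_top.1 htop))

theorem coeffMap_ne_zero [RightComodule k C N] {g : Module.Dual k N} (hg : g ≠ 0) :
    coeffMap (C := C) g ≠ 0 := fun h => hg (by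
  rw [← counit_coeffMap (C := C) g, h, LinearMap.comp_zero])

/-- A simple right comodule has an injective envelope. -/
theorem exists_isInjectiveEnvelope {S : Type w} [AddCommGroup S] [Module k S]
    [RightComodule k C S] (hS : IsSimple k C S) :
    ∃ (E : Type (max v x)) (_ : AddCommGroup E) (_ : Module k E) (_ : RightComodule k C E)
      (ι : S →ₗ[k] E), IsInjectiveEnvelope k C ι := by
  let _ := regular k C
  have := hS.1
  obtain ⟨n, hn⟩ := exists_ne (0 : Module.Dual k S)
  let i : S →ₗ[k] C := coeffMap n
  have hi : IsHom k C i := isHom_coeffMap n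
  have hinj : Function.Injective i := injective_of_isSimple hS hi (coeffMap_ne_zero hn)
  obtain ⟨g, hg, hgg, hSg, hess⟩ := exists_idempotent_essential (k := k) (C := C)
    (S := LinearMap.range i) (isSubcomodule_iff.2 fun f c hc => by
      obtain ⟨d, rfl⟩ := hc
      exact ⟨act f d, LinearMap.congr_fun (hi.act_comm f).symm d⟩)
  let u : ULift.{x} (LinearMap.range g) ≃ₗ[k] LinearMap.range g := ULift.moduleEquiv
  let j : ULift.{x} (LinearMap.range g) →ₗ[k] C := (LinearMap.range g).subtype ∘ₗ u.toLinearMap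
  let r : C →ₗ[k] ULift.{x} (LinearMap.range g) := u.symm.toLinearMap ∘ₗ g.rangeRestrict
  have hj_inj : Function.Injective j := Subtype.val_injective.comp u.injective
  have hjr : j ∘ₗ r = g := rfl
  have hrj : r ∘ₗ j = LinearMap.id := by
    refine LinearMap.ext fun y => ?_
    obtain ⟨c, hc⟩ := (u y).2
    apply hj_inj
    change g (u y : C) = u y
    rw [← hc]
    exact LinearMap.congr_fun hgg c
  obtain ⟨σ, hj, hr⟩ := exists_of_retract j r hrj (hjr ▸ hg)
  have hji : j ∘ₗ r ∘ₗ i = i := by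
    ext s
    obtain ⟨c, hc⟩ := hSg ⟨s, rfl⟩
    change g (i s) = i s
    rw [← hc]
    exact LinearMap.congr_fun hgg c
  refine ⟨_, _, _, σ, r ∘ₗ i, IsHom.comp hr hi, fun a b hab => hinj ?_,
    isInjective_of_retract j r hrj hj hr, fun W hW hWι => ?_⟩
  · rw [← hji]
    exact congrArg j hab
  · have h1 : W.map j = ⊥ := by
      refine hess _ (isSubcomodule_iff.2 ?_) ?_ (Submodule.disjoint_def.2 ?_)
      · rintro f _ ⟨y, hy, rfl⟩
        exact ⟨act f y, isSubcomodule_iff.1 hW f y hy,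
          LinearMap.congr_fun (hj.act_comm f).symm y⟩
      · rintro _ ⟨y, -, rfl⟩
        exact (u y).2
      · rintro _ ⟨y, hy, rfl⟩ ⟨s, hs⟩
        have hys : y = r (i s) := hj_inj (hs.symm.trans (LinearMap.congr_fun hji s).symm)
        have : y ∈ W ⊓ LinearMap.range (r ∘ₗ i) := ⟨hy, s, hys.symm⟩
        rw [hWι, Submodule.mem_bot] at this
        rw [this, map_zero]
    refine (Submodule.eq_bot_iff _).2 fun y hy => hj_inj ?_
    rw [map_zero]
    exact (Submodule.eq_bot_iff _).1 h1 _ ⟨y, hy, rfl⟩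

theorem op_smul_dual_eq_coeffMap [RightComodule k C N] (f : DualAlgebra k C)
    (g : Module.Dual k N) : op f • g = f.ofConv ∘ₗ coeffMap g :=
  LinearMap.ext fun n => (apply_coeffMap g f n).symm

/-- If `E` is injective, a linear form `n` on `E` with injective coefficient map makes `E^*` a
projective module. -/
theorem projective_dual {E : Type (max v x)} [AddCommGroup E] [Module k E] [RightComodule k C E]
    (hE : IsInjective k C E) {n : Module.Dual k E} (hn : Function.Injective (coeffMap (C := C) n)) :
    Module.Projective (DualAlgebra k C)ᵐᵒᵖ (Module.Dual k E) := by
  let _ := regular k C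
  -- Injectivity of `E` is tested only on comodules in its own universe, hence a lifted copy of `C`.
  let u : ULift.{x} C ≃ₗ[k] C := ULift.moduleEquiv
  obtain ⟨_, hu, hu'⟩ := exists_of_retract (k := k) (C := C) u.toLinearMap u.symm.toLinearMap
    (by ext; simp) (by rw [isHom_iff]; intro f; ext c; simp)
  obtain ⟨r', hr', hr'n⟩ := hE E (ULift.{x} C) (u.symm.toLinearMap ∘ₗ coeffMap n) LinearMap.id
    (IsHom.comp hu' (isHom_coeffMap n)) (u.symm.injective.comp hn)
    (isHom_iff.2 fun f => by rw [LinearMap.comp_id, LinearMap.id_comp])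
  let r : C →ₗ[k] E := r' ∘ₗ u.symm.toLinearMap
  have hr : IsHom k C r := IsHom.comp hr' hu'
  let s : Module.Dual k E →ₗ[(DualAlgebra k C)ᵐᵒᵖ] (DualAlgebra k C)ᵐᵒᵖ :=
    { toFun := fun g => op ⟨g ∘ₗ r⟩
      map_add' := fun g g' => rfl
      map_smul' := fun a g => by
        refine unop_injective (WithConv.ext (LinearMap.ext fun c => ?_))
        have h1 := mul_apply_eq (⟨g ∘ₗ r⟩ : DualAlgebra k C) a.unop c
        refine Eq.trans ?_ h1.symm
        exact congrArg g (LinearMap.congr_fun (hr.act_comm a.unop) c) }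
  -- Since `r` retracts `coeffMap n`, one has `n · (g ∘ r) = g`: `E^*` is a summand of `C^*`.
  refine Module.Projective.of_split s (LinearMap.toSpanSingleton _ _ n) (LinearMap.ext fun g => ?_)
  change op (⟨g ∘ₗ r⟩ : DualAlgebra k C) • n = g
  rw [op_smul_dual_eq_coeffMap]
  change g ∘ₗ (r' ∘ₗ u.symm.toLinearMap ∘ₗ coeffMap n) = g
  rw [hr'n, LinearMap.comp_id]

/-- The dual of an injective envelope of a simple comodule is a projective cover. -/
theorem IsInjectiveEnvelope.isProjectiveCover {S M : Type*} [AddCommGroup S] [Module k S]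
    [RightComodule k C S] (hS : IsSimple k C S) [AddCommGroup M]
    [Module (DualAlgebra k C)ᵐᵒᵖ M] (e : Module.Dual k S ≃ₗ[(DualAlgebra k C)ᵐᵒᵖ] M)
    {E : Type (max v x)} [AddCommGroup E] [Module k E] [RightComodule k C E] {ι : S →ₗ[k] E}
    (hι : IsInjectiveEnvelope k C ι) :
    IsProjectiveCover (e.toLinearMap ∘ₗ dualMap ι hι.isHom) := by
  let _ := regular k C
  have hcoeff : ∀ n : Module.Dual k E, n ∘ₗ ι ≠ 0 → Function.Injective (coeffMap (C := C) n) := by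
    intro n hn
    have hhom : IsHom k C (coeffMap (C := C) n) := isHom_coeffMap n
    have hinj : Function.Injective (coeffMap (C := C) n ∘ₗ ι) := by
      refine injective_of_isSimple hS (IsHom.comp hhom hι.isHom) fun h0 => hn ?_
      rw [← counit_coeffMap (C := C) n, LinearMap.comp_assoc, h0, LinearMap.comp_zero]
    -- The kernel is a subcomodule meeting the image of `S` trivially, so essentiality kills it.
    refine LinearMap.ker_eq_bot.1 (hι.essential _ (isSubcomodule_ker hhom)
      ((Submodule.eq_bot_iff _).2 ?_))
    rintro _ ⟨hy, s, rfl⟩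
    have : s = 0 := hinj (by rw [map_zero]; exact hy)
    rw [this, map_zero]
  obtain ⟨l, hl⟩ := ι.exists_leftInverse_of_injective (LinearMap.ker_eq_bot.2 hι.injective)
  have := hS.1
  obtain ⟨φ, hφ⟩ := exists_ne (0 : Module.Dual k S)
  have hext : ∀ φ : Module.Dual k S, (φ ∘ₗ l) ∘ₗ ι = φ := fun φ => by
    rw [LinearMap.comp_assoc, hl, LinearMap.comp_id]
  refine ⟨projective_dual hι.isInjective (hcoeff (φ ∘ₗ l) (by rwa [hext])), fun m => ?_,
    fun N hN => ?_⟩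
  · refine ⟨e.symm m ∘ₗ l, ?_⟩
    change e ((e.symm m ∘ₗ l) ∘ₗ ι) = m
    rw [hext, LinearEquiv.apply_symm_apply]
  · have hmem : φ ∘ₗ l ∈ N ⊔ LinearMap.ker (e.toLinearMap ∘ₗ dualMap ι hι.isHom) := by
      rw [hN]
      exact Submodule.mem_top
    obtain ⟨n, hn, s, hs, hns⟩ := Submodule.mem_sup.1 hmem
    have hs0 : s ∘ₗ ι = 0 := e.injective ((LinearMap.mem_ker.1 hs).trans (map_zero e).symm)
    have hnι : n ∘ₗ ι ≠ 0 := by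
      have h1 : (n + s) ∘ₗ ι = φ := by rw [hns, hext]
      rw [LinearMap.add_comp, hs0, add_zero] at h1
      rwa [h1]
    -- The form `n ∈ N` is nonzero on `S` and so generates `E^*`: `g = n · (g ∘ l')`, where `l'`
    -- need only be linear.
    obtain ⟨l', hl'⟩ := (coeffMap (C := C) n).exists_leftInverse_of_injective
      (LinearMap.ker_eq_bot.2 (hcoeff n hnι))
    refine eq_top_iff.2 fun g _ => ?_
    have hg : op (⟨g ∘ₗ l'⟩ : DualAlgebra k C) • n = g := by
      rw [op_smul_dual_eq_coeffMap, LinearMap.comp_assoc, hl', LinearMap.comp_id]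
    rw [← hg]
    exact N.smul_mem _ hn

end

end RightComodule

/-! ### Simple rational modules and their duals. -/

section Rational

theorem exists_op_smul_eq {k C M : Type*} [Field k] [AddCommGroup C] [Module k C]
    [Coalgebra k C] [AddCommGroup M] [Module (DualAlgebra k C)ᵐᵒᵖ M]
    [IsSimpleModule (DualAlgebra k C)ᵐᵒᵖ M] {m : M} (hm : m ≠ 0) (m' : M) :
    ∃ f : DualAlgebra k C, op f • m = m' := by
  obtain ⟨a, ha⟩ := IsSimpleModule.toSpanSingleton_surjective (DualAlgebra k C)ᵐᵒᵖ hm m'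
  exact ⟨a.unop, ha⟩

variable {k : Type u} {C : Type v} {M : Type w} [Field k] [AddCommGroup C] [Module k C]
  [Coalgebra k C] [AddCommGroup M] [Module k M]

variable [Module (DualAlgebra k C)ᵐᵒᵖ M]

/-- A simple right `C^*`-module with a projective cover is rational. -/
theorem IsProjectiveCover.isRational [IsScalarTower k (DualAlgebra k C)ᵐᵒᵖ M]
    [IsSimpleModule (DualAlgebra k C)ᵐᵒᵖ M] {P : Type*}
    [AddCommGroup P] [Module (DualAlgebra k C)ᵐᵒᵖ P] {p : P →ₗ[(DualAlgebra k C)ᵐᵒᵖ] M}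
    (hp : IsProjectiveCover p) : IsRational k C M := by
  let _ := RightComodule.regular k C
  have := hp.projective
  have := IsSimpleModule.nontrivial (DualAlgebra k C)ᵐᵒᵖ M
  have hlocal : ∀ J : Submodule (DualAlgebra k C)ᵐᵒᵖ P, J ≠ ⊤ → J ≤ LinearMap.ker p := by
    intro J hJ
    by_contra hJp
    have hmap : J.map p = ⊤ := (eq_bot_or_eq_top (J.map p)).resolve_left fun h0 =>
      hJp (LinearMap.le_ker_iff_map.2 h0)
    refine hJ (hp.superfluous J (eq_top_iff.2 fun y _ => ?_))
    obtain ⟨z, hz, hzy⟩ : p y ∈ J.map p := hmap ▸ Submodule.mem_top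
    refine Submodule.mem_sup.2 ⟨z, hz, y - z, ?_, add_sub_cancel _ _⟩
    rw [LinearMap.mem_ker, map_sub, hzy, sub_self]
  obtain ⟨m, hm⟩ := exists_ne (0 : M)
  obtain ⟨x, rfl⟩ := hp.surjective m
  have hspan : LinearMap.range (LinearMap.toSpanSingleton (DualAlgebra k C)ᵐᵒᵖ P x) = ⊤ := by
    by_contra h
    exact hm (hlocal _ h ⟨1, one_smul _ x⟩)
  -- A section of `C^* → P`, `a ↦ x · a`; the value `e` of `s` at `x` is idempotent and `P ≅ e C^*`.
  obtain ⟨s, hs⟩ := Module.projective_lifting_property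
    (LinearMap.toSpanSingleton (DualAlgebra k C)ᵐᵒᵖ P x) LinearMap.id
    (LinearMap.range_eq_top.1 hspan)
  let e : DualAlgebra k C := (s x).unop
  have hex : op e • x = x := LinearMap.congr_fun hs x
  have hsx : ∀ a, s (a • x) = a * op e := fun a => map_smul s a x
  have hee : e * e = e := op_injective (by
    rw [op_mul, ← hsx, hex]
    rfl)
  let h : C →ₗ[k] C := RightComodule.coeffMap e.ofConv
  have hh : RightComodule.IsHom k C h := RightComodule.isHom_coeffMap _
  have hf : ∀ (f : DualAlgebra k C) (c : C), f.ofConv (h c) = (e * f).ofConv c := fun f c =>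
    (RightComodule.apply_coeffMap e.ofConv f c).trans (RightComodule.mul_apply_eq e f c).symm
  have h0 : h ≠ 0 := RightComodule.coeffMap_ne_zero fun he => by
    have he' : e = 0 := WithConv.ext he
    rw [he'] at hex
    exact hm (by rw [hex.symm.trans (zero_smul (DualAlgebra k C)ᵐᵒᵖ x), map_zero])
  obtain ⟨d, hd⟩ : ∃ d, h d ≠ 0 := by
    by_contra! hall
    exact h0 (LinearMap.ext hall)
  obtain ⟨c, hc0, hc⟩ : ∃ c, c ≠ 0 ∧ h c = c := by
    refine ⟨h d, hd, RightComodule.ext_forms (k := k) fun f => ?_⟩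
    rw [hf ⟨f⟩, hf ⟨f⟩, hf (e * ⟨f⟩), ← mul_assoc, hee]
  obtain ⟨W, _, hW⟩ :=
    exists_finite_contractRightFactor_mem (RightComodule.coact (k := k) (C := C) c)
  let F : Submodule k C := Submodule.span k (Set.range fun f : DualAlgebra k C =>
    RightComodule.act f c)
  have hFW : F ≤ W := Submodule.span_le.2 (by
    rintro _ ⟨f, rfl⟩
    exact hW f.ofConv)
  have : FiniteDimensional k F := Submodule.finiteDimensional_of_le hFW
  -- The annihilator of `F = C^* · c`, a right ideal of `C^*`.
  let I : Submodule (DualAlgebra k C)ᵐᵒᵖ (DualAlgebra k C)ᵐᵒᵖ :=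
    { carrier := {a | ∀ g : DualAlgebra k C, a.unop.ofConv (RightComodule.act g c) = 0}
      add_mem' := fun {a b} ha hb g => by
        change a.unop.ofConv _ + b.unop.ofConv _ = 0
        rw [ha g, hb g, add_zero]
      zero_mem' := fun g => rfl
      smul_mem' := fun b a ha g => by
        have h1 := RightComodule.mul_apply_eq a.unop b.unop (RightComodule.act g c)
        exact h1.trans ((congrArg a.unop.ofConv (LinearMap.congr_fun
          (RightComodule.act_mul b.unop g) c).symm).trans (ha _)) }
  -- If `x = x · a` with `a ∈ I`, then `e = e a`, and `f(c) = e(f · c) = a(h(f · c)) = a(f · c) = 0`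
  -- for all `f`, contradicting `c ≠ 0`.
  have hI : I.map (LinearMap.toSpanSingleton (DualAlgebra k C)ᵐᵒᵖ P x) ≠ ⊤ := by
    intro htop
    obtain ⟨a, ha, hax⟩ : x ∈ I.map (LinearMap.toSpanSingleton (DualAlgebra k C)ᵐᵒᵖ P x) :=
      htop ▸ Submodule.mem_top
    have hea : e = e * a.unop := op_injective (by
      rw [op_mul, op_unop]
      exact (congrArg s hax.symm).trans (hsx a))
    refine hc0 (RightComodule.ext_forms (k := k) fun f => ?_)
    have h1 : f (h c) = e.ofConv (RightComodule.act ⟨f⟩ c) :=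
      RightComodule.apply_coeffMap e.ofConv ⟨f⟩ c
    have h2 : h (RightComodule.act ⟨f⟩ c) = RightComodule.act ⟨f⟩ (h c) :=
      LinearMap.congr_fun (hh.act_comm ⟨f⟩).symm c
    rw [hc, hea, ← hf, h2, hc, ha] at h1
    rw [h1, map_zero]
  let θ : Module.Dual k C →ₗ[k] M :=
    { toFun := fun f => op (⟨f⟩ : DualAlgebra k C) • p x
      map_add' := fun f g => add_smul (op (⟨f⟩ : DualAlgebra k C)) (op ⟨g⟩) (p x)
      map_smul' := fun a f => smul_assoc a (op (⟨f⟩ : DualAlgebra k C)) (p x) }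
  obtain ⟨t, ht⟩ := exists_eq_contractLeftFactor F θ fun f hfF => by
    change op (⟨f⟩ : DualAlgebra k C) • p x = 0
    rw [← map_smul]
    exact hlocal _ hI ⟨op ⟨f⟩, fun g => hfF _ (Submodule.subset_span ⟨g, rfl⟩), rfl⟩
  refine LeftComodule.isRational_of_forall_exists fun m' => ?_
  obtain ⟨g, rfl⟩ := exists_op_smul_eq (k := k) (C := C) hm m'
  refine ⟨contractLeftFactor (C ⊗[k] M) g.ofConv (TensorProduct.assoc k C C M
    ((Coalgebra.comul (R := k) (A := C)).rTensor M t)), fun f => ?_⟩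
  rw [LeftComodule.contractLeftFactor_comul, ← mul_smul, ← op_mul]
  exact ht (g * f).ofConv

/-- A left comodule whose underlying right `C^*`-module is simple is finite-dimensional. -/
theorem LeftComodule.Induces.finiteDimensional [IsSimpleModule (DualAlgebra k C)ᵐᵒᵖ M]
    [LeftComodule k C M] (h : LeftComodule.Induces k C M) : FiniteDimensional k M := by
  have := IsSimpleModule.nontrivial (DualAlgebra k C)ᵐᵒᵖ M
  obtain ⟨m, hm⟩ := exists_ne (0 : M)
  obtain ⟨W, hW, hmW⟩ := exists_finite_contractLeftFactor_mem (coact (k := k) (C := C) m)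
  -- `M = m C^*` lies in the finite-dimensional space containing all contractions of `ρ(m)`.
  have hWtop : W = ⊤ := eq_top_iff.2 fun m' _ => by
    obtain ⟨f, rfl⟩ := exists_op_smul_eq (k := k) (C := C) hm m'
    rw [h f m]
    exact hmW f.ofConv
  rw [hWtop] at hW
  exact Module.finite_def.2 (Module.Finite.iff_fg.1 hW)

theorem LeftComodule.Induces.isSimple [IsSimpleModule (DualAlgebra k C)ᵐᵒᵖ M]
    [LeftComodule k C M] (h : LeftComodule.Induces k C M) : LeftComodule.IsSimple k C M := by
  refine ⟨IsSimpleModule.nontrivial (DualAlgebra k C)ᵐᵒᵖ M, fun W hW => ?_⟩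
  let W' : Submodule (DualAlgebra k C)ᵐᵒᵖ M :=
    { W with
      smul_mem' := fun a m hm => by
        obtain ⟨t, ht⟩ := hW m hm
        change op a.unop • m ∈ W
        rw [h, LeftComodule.act_apply, ← ht, contractLeftFactor_lTensor]
        exact Subtype.property _ }
  have hmem : ∀ m, m ∈ W' ↔ m ∈ W := fun _ => Iff.rfl
  rcases eq_bot_or_eq_top W' with h0 | h1
  · exact Or.inl (Submodule.ext fun m => by rw [← hmem, h0]; simp)
  · exact Or.inr (Submodule.ext fun m => by rw [← hmem, h1]; simp)

/-- The dual of a finite-dimensional rational module is a right comodule. -/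
theorem RightComodule.exists_inducesDual [FiniteDimensional k M] [LeftComodule k C M]
    (h : LeftComodule.Induces k C M) :
    ∃ _ : RightComodule k C (Module.Dual k M), RightComodule.InducesDual k C M := by
  obtain ⟨σ, hσ⟩ := RightComodule.exists_act_eq (k := k) (C := C) (N := Module.Dual k M)
    (fun f => Module.Dual.transpose (R := k) (LeftComodule.act f : M →ₗ[k] M))
    (by
      ext φ m
      change φ (LeftComodule.act (1 : DualAlgebra k C) m) = φ m
      rw [← h, op_one, one_smul])
    (fun f g => by
      ext φ m
      change φ (LeftComodule.act (f * g) m) = φ (LeftComodule.act g (LeftComodule.act f m))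
      rw [← h, ← h, ← h, op_mul, mul_smul])
    (fun φ => by
      let β : M →ₗ[k] C :=
        contractRightFactor C φ ∘ₗ LeftComodule.coact (k := k) (C := C) (M := M)
      -- Finite dimension gives `M^* ⊗ C ≅ Hom(M, C)`; the coaction of `φ` is the tensor of `m ↦ ∑
      -- φ(m₀) m₋₁`.
      obtain ⟨t, ht⟩ := (dualTensorHomEquiv k M C).surjective β
      refine ⟨t, fun f => LinearMap.ext fun m => ?_⟩
      have h1 : ∀ s : Module.Dual k M ⊗[k] C, (contractRightFactor (Module.Dual k M) f.ofConv s) m =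
          f.ofConv (dualTensorHomEquiv k M C s m) := by
        intro s
        induction s using TensorProduct.induction_on with
        | zero => simp
        | tmul a b => simp [mul_comm]
        | add a b ha hb => simp only [map_add, LinearMap.add_apply, ha, hb]
      rw [h1, ht]
      change φ (LeftComodule.act f m) = f.ofConv (contractRightFactor C φ (LeftComodule.coact m))
      rw [LeftComodule.act_apply]
      induction LeftComodule.coact (k := k) (C := C) m using TensorProduct.induction_on with
      | zero => simp
      | tmul a b => simp [mul_comm]
      | add a b ha hb => simp only [map_add, ha, hb])
  refine ⟨σ, fun f φ m => ?_⟩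
  rw [hσ, h f m]
  rfl

/-- The common kernel in `M` of the forms in a subcomodule is a `C^*`-submodule, and in finite
dimension it determines the subcomodule. -/
theorem RightComodule.InducesDual.isSimple [IsSimpleModule (DualAlgebra k C)ᵐᵒᵖ M]
    [FiniteDimensional k M] [RightComodule k C (Module.Dual k M)]
    (h : RightComodule.InducesDual k C M) : RightComodule.IsSimple k C (Module.Dual k M) := by
  have := IsSimpleModule.nontrivial (DualAlgebra k C)ᵐᵒᵖ M
  refine ⟨inferInstance, fun W hW => ?_⟩
  rw [RightComodule.isSubcomodule_iff] at hW
  let W' : Submodule (DualAlgebra k C)ᵐᵒᵖ M :=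
    { W.dualCoannihilator with
      smul_mem' := fun a m hm => by
        change op a.unop • m ∈ W.dualCoannihilator
        change m ∈ W.dualCoannihilator at hm
        rw [Submodule.mem_dualCoannihilator] at hm ⊢
        intro φ hφ
        rw [← h]
        exact hm _ (hW _ φ hφ) }
  have hmem : ∀ m, m ∈ W' ↔ m ∈ W.dualCoannihilator := fun _ => Iff.rfl
  rw [← Subspace.dualCoannihilator_dualAnnihilator_eq (W := W)]
  rcases eq_bot_or_eq_top W' with h0 | h1
  · right
    rw [show W.dualCoannihilator = ⊥ from Submodule.ext fun m => by rw [← hmem, h0]; simp,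
      Submodule.dualAnnihilator_bot]
  · left
    rw [show W.dualCoannihilator = ⊤ from Submodule.ext fun m => by rw [← hmem, h1]; simp,
      Submodule.dualAnnihilator_top]

/-- The inverse of evaluation, as an isomorphism of right `C^*`-modules. -/
theorem RightComodule.InducesDual.exists_equiv [FiniteDimensional k M]
    [RightComodule k C (Module.Dual k M)] (h : RightComodule.InducesDual k C M) :
    ∃ e : Module.Dual k (Module.Dual k M) ≃ₗ[(DualAlgebra k C)ᵐᵒᵖ] M,
      ∀ m : M, e (Module.Dual.eval k M m) = m := by
  let ev : M ≃ₗ[k] Module.Dual k (Module.Dual k M) := Module.evalEquiv k M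
  let e : M ≃ₗ[(DualAlgebra k C)ᵐᵒᵖ] Module.Dual k (Module.Dual k M) :=
    { ev.toAddEquiv with
      map_smul' := fun a m => LinearMap.ext fun φ => (h a.unop φ m).symm }
  exact ⟨e.symm, fun m => e.symm_apply_apply m⟩

end Rational

theorem mainTheorem9 {k : Type u} {C : Type v} {M : Type w}
    [Field k] [AddCommGroup C] [Module k C] [Coalgebra k C]
    [AddCommGroup M] [Module k M] [Module (DualAlgebra k C)ᵐᵒᵖ M]
    [IsScalarTower k (DualAlgebra k C)ᵐᵒᵖ M] [IsSimpleModule (DualAlgebra k C)ᵐᵒᵖ M] :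
    -- existence of a projective cover is rationality
    (HasProjectiveCover.{max u v, w, max u v w x} (DualAlgebra k C)ᵐᵒᵖ M ↔ IsRational k C M) ∧
    -- rationality is: the structure comes from a simple left comodule structure
    (IsRational k C M ↔
      ∃ _ : LeftComodule k C M, LeftComodule.Induces k C M ∧ LeftComodule.IsSimple k C M) ∧
    -- in that case `S = M^*` is a simple right comodule, `S^* ≃ M`, and `E(S)^*` is the cover
    (IsRational k C M →
      (∃! σ : RightComodule k C (Module.Dual k M), RightComodule.InducesDual k C M) ∧
      ∀ σ : RightComodule k C (Module.Dual k M), RightComodule.InducesDual k C M →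
        RightComodule.IsSimple k C (Module.Dual k M) ∧
        ∃ e : Module.Dual k (Module.Dual k M) ≃ₗ[(DualAlgebra k C)ᵐᵒᵖ] M,
          (∀ m : M, e (Module.Dual.eval k M m) = m) ∧
          (∃ (E : Type (max u v w x)) (_ : AddCommGroup E) (_ : Module k E)
            (_ : RightComodule k C E) (ι : Module.Dual k M →ₗ[k] E),
            RightComodule.IsInjectiveEnvelope k C ι) ∧
          ∀ (E : Type (max u v w x)) [AddCommGroup E] [Module k E] [RightComodule k C E]
            (ι : Module.Dual k M →ₗ[k] E) (hι : RightComodule.IsInjectiveEnvelope k C ι),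
            IsProjectiveCover (e.toLinearMap ∘ₗ RightComodule.dualMap ι hι.isHom)) := by
  have dual : IsRational k C M →
      (∃! σ : RightComodule k C (Module.Dual k M), RightComodule.InducesDual k C M) ∧
      ∀ σ : RightComodule k C (Module.Dual k M), RightComodule.InducesDual k C M →
        RightComodule.IsSimple k C (Module.Dual k M) ∧
        ∃ e : Module.Dual k (Module.Dual k M) ≃ₗ[(DualAlgebra k C)ᵐᵒᵖ] M,
          (∀ m : M, e (Module.Dual.eval k M m) = m) ∧
          (∃ (E : Type (max u v w x)) (_ : AddCommGroup E) (_ : Module k E)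
            (_ : RightComodule k C E) (ι : Module.Dual k M →ₗ[k] E),
            RightComodule.IsInjectiveEnvelope k C ι) ∧
          ∀ (E : Type (max u v w x)) [AddCommGroup E] [Module k E] [RightComodule k C E]
            (ι : Module.Dual k M →ₗ[k] E) (hι : RightComodule.IsInjectiveEnvelope k C ι),
            IsProjectiveCover (e.toLinearMap ∘ₗ RightComodule.dualMap ι hι.isHom) := by
    rintro ⟨_, hρ⟩
    have := hρ.finiteDimensional
    refine ⟨?_, fun σ hσ => ?_⟩
    · obtain ⟨σ, hσ⟩ := RightComodule.exists_inducesDual hρ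
      refine ⟨σ, hσ, fun τ hτ => RightComodule.ext_of_act fun f => ?_⟩
      exact LinearMap.ext fun φ => LinearMap.ext fun m => (hτ f φ m).trans (hσ f φ m).symm
    · obtain ⟨e, he⟩ := hσ.exists_equiv
      exact ⟨hσ.isSimple, e, he,
        RightComodule.exists_isInjectiveEnvelope.{u, v, max u w, max u w x} hσ.isSimple,
        fun E _ _ _ ι hι =>
          RightComodule.IsInjectiveEnvelope.isProjectiveCover.{u, v, max u w x} hσ.isSimple e hι⟩
  refine ⟨⟨?_, fun h => ?_⟩, ⟨?_, ?_⟩, dual⟩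
  · rintro ⟨P, _, _, p, hp⟩
    exact hp.isRational
  · obtain ⟨⟨σ, hσ, -⟩, hdual⟩ := dual h
    obtain ⟨-, e, -, ⟨E, _, _, _, ι, hι⟩, hcover⟩ := hdual σ hσ
    exact ⟨_, _, _, _, hcover E ι hι⟩
  · rintro ⟨ρ, hρ⟩
    exact ⟨ρ, hρ, hρ.isSimple⟩
  · rintro ⟨ρ, hρ, -⟩
    exact ⟨ρ, hρ⟩
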